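/- Let $M\subseteq\mathbb P^N$ be an $n$-dimensional (irreducible, reduced, possibly singular) complex projective variety, and let $G$ be a compact connected Lie group of (real) dimension $g\le n$ acting holomorphically on $M$. Let $\mathrm{Pic}^G(M)$ be the group of isomorphism classes of $G$-linearized holomorphic line bundles on $M$, with the tensor product. For $L\in\mathrm{Pic}^G(M)$ let $H^0(M,L^{\otimes k})_0=H^0(M,L^{\otimes k})^G$ be the space of $G$-invariant holomorphic sections of $L^{\otimes k}$ (the isotypic component of the trivial representation), and put $$\mathrm{vol}_0(L)=\limsup_{k\to+\infty}\frac{(n-g)!}{k^{\,n-g}}\dim H^0(M,L^{\otimes k})_0\in[0,+\infty].$$ (1) For every $L\in\mathrm{Pic}^G(M)$ and every integer $q\ge 1$, $$\mathrm{vol}_0(L^{\otimes q})=q^{\,n-g}\,\mathrm{vol}_0(L).$$ (2) Consequently $\mathrm{vol}_0$ extends to rational classes: let $P\subseteq\mathrm{Pic}^G(M)$ be any subgroup such that $\mathrm{vol}_0(L)$ depends only on the class of $L$ in $\mathrm{Pic}^G(M)/P$ (for instance $P$ trivial). Then there is exactly one function $$v:\bigl(\mathrm{Pic}^G(M)/P\bigr)\otimes_{\mathbb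 Z}\mathbb Q\longrightarrow[0,+\infty]$$ such that $v([L]\otimes 1)=\mathrm{vol}_0(L)$ for every $L\in\mathrm{Pic}^G(M)$, and $v(c\,x)=c^{\,n-g}\,v(x)$ for every class $x$ and every rational number $c>0$. -/

import Mathlib

open Filter Topology
open scoped Nat ENNReal TensorProduct Manifold ContDiff

noncomputable section

namespace EquivVol

/-! ### Projective varieties and holomorphic functions on them -/

/-- Complex projective space `ℙ^N`. -/
abbrev ProjSpace (N : ℕ) : Type := Projectivization ℂ (Fin (N + 1) → ℂ)

/-- The classical topology of `ℙ^N`: the quotient topology from `ℂ^(N+1) ∖ {0}`. -/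
instance instTopProjSpace (N : ℕ) : TopologicalSpace (ProjSpace N) :=
  TopologicalSpace.coinduced
    (fun v : {v : Fin (N + 1) → ℂ // v ≠ 0} => Projectivization.mk ℂ v.1 v.2) inferInstance

/-- `X` is the zero locus in `ℙ^N` of a set of homogeneous polynomials. -/
def IsAlgebraicSet {N : ℕ} (X : Set (ProjSpace N)) : Prop :=
  ∃ S : Set (MvPolynomial (Fin (N + 1)) ℂ),
    (∀ P ∈ S, ∃ d : ℕ, P.IsHomogeneous d) ∧
    X = {x | ∀ P ∈ S, MvPolynomial.eval x.rep P = 0}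

/-- The function `f` on `X ⊆ ℙ^N` is holomorphic at `p` (a section near `p` of the structure sheaf
of the reduced complex space `X`): near `p` it is the restriction of a holomorphic function of the
ambient space, written in homogeneous coordinates. -/
def HolAt {N : ℕ} {X : Set (ProjSpace N)} (f : X → ℂ) (p : X) : Prop :=
  ∃ F : (Fin (N + 1) → ℂ) → ℂ, AnalyticAt ℂ F p.1.rep ∧
    ∀ᶠ w in 𝓝 p.1.rep, ∀ (hw : w ≠ 0) (hX : Projectivization.mk ℂ w hw ∈ X),
      f ⟨Projectivization.mk ℂ w hw, hX⟩ = F w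

/-- `Z` is a closed analytic subset of `X`: near every point of `X` it is the common zero locus of
finitely many holomorphic functions. -/
def IsAnalyticSubset {N : ℕ} {X : Set (ProjSpace N)} (Z : Set X) : Prop :=
  ∀ p : X, ∃ (r : ℕ) (f : Fin r → X → ℂ),
    (∀ i, HolAt (f i) p) ∧ ∀ᶠ q in 𝓝 p, q ∈ Z ↔ ∀ i, f i q = 0

/-- A complex projective variety: a non-empty algebraic subset `X` of `ℙ^N` which is irreducible
(not the union of two proper closed analytic subsets). -/
structure IsProjectiveVariety {N : ℕ} (X : Set (ProjSpace N)) : Prop where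
  algebraic : IsAlgebraicSet X
  nonempty : X.Nonempty
  irreducible : ∀ Z₁ Z₂ : Set X, IsAnalyticSubset Z₁ → IsAnalyticSubset Z₂ →
    Z₁ ∪ Z₂ = Set.univ → Z₁ = Set.univ ∨ Z₂ = Set.univ

/-- The (complex) dimension of `X`: the supremum of the lengths of chains of projective varieties
contained in `X`. -/
def dimension {N : ℕ} (X : Set (ProjSpace N)) : WithBot ℕ∞ :=
  Order.krullDim {Z : Set (ProjSpace N) // IsProjectiveVariety Z ∧ Z ⊆ X}

/-- A holomorphic self-map of `X`: continuous, and it pulls germs of holomorphic functions back to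
germs of holomorphic functions. -/
structure IsHolMap {N : ℕ} {X : Set (ProjSpace N)} (ξ : X → X) : Prop where
  continuous : Continuous ξ
  pullback : ∀ (p : X) (f : X → ℂ), HolAt f (ξ p) → HolAt (fun q => f (ξ q)) p

/-- The topological group `G` acts holomorphically on `X`: the action `G × X → X` is continuous and
every element of `G` acts by a holomorphic map. -/
class HolomorphicAction (G : Type*) [Group G] [TopologicalSpace G] {N : ℕ}
    (X : Set (ProjSpace N)) [MulAction G X] : Prop where
  continuous_action : Continuous fun x : G × X => x.1 • x.2
  holomorphic : ∀ g : G, IsHolMap fun m : X => g • m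

section HolAtLemmas

variable {N : ℕ} {X : Set (ProjSpace N)} {f f' : X → ℂ} {p : X}

theorem HolAt.const (c : ℂ) : HolAt (fun _ : X => c) p :=
  ⟨fun _ => c, analyticAt_const, Eventually.of_forall fun _ _ _ => rfl⟩

theorem HolAt.mul (h : HolAt f p) (h' : HolAt f' p) : HolAt (fun q => f q * f' q) p := by
  obtain ⟨F, hF, e⟩ := h
  obtain ⟨F', hF', e'⟩ := h'
  refine ⟨fun w => F w * F' w, hF.mul hF', ?_⟩
  filter_upwards [e, e'] with w h1 h2 hw hX
  rw [h1 hw hX, h2 hw hX]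

theorem HolAt.of_eq (h : HolAt f p) (e : ∀ q, f' q = f q) : HolAt f' p := by
  rwa [funext e]

theorem HolAt.add (h : HolAt f p) (h' : HolAt f' p) : HolAt (fun q => f q + f' q) p := by
  obtain ⟨F, hF, e⟩ := h
  obtain ⟨F', hF', e'⟩ := h'
  refine ⟨fun w => F w + F' w, hF.add hF', ?_⟩
  filter_upwards [e, e'] with w h1 h2 hw hX
  rw [h1 hw hX, h2 hw hX]

theorem HolAt.inv (h : HolAt f p) (h0 : f p ≠ 0) : HolAt (fun q => (f q)⁻¹) p := by
  obtain ⟨F, hF, e⟩ := h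
  have hp : Projectivization.mk ℂ p.1.rep p.1.rep_nonzero = p.1 := p.1.mk_rep
  have hne : F p.1.rep ≠ 0 := by
    have := e.self_of_nhds p.1.rep_nonzero (by rw [hp]; exact p.2)
    rw [← this]
    have h2 : (⟨Projectivization.mk ℂ p.1.rep p.1.rep_nonzero, by rw [hp]; exact p.2⟩ : X) = p :=
      Subtype.ext hp
    rwa [h2]
  refine ⟨fun w => (F w)⁻¹, hF.inv hne, ?_⟩
  filter_upwards [e] with w h1 hw hX
  rw [h1 hw hX]

end HolAtLemmas

/-! ### Complex lines -/

section Lines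

variable {V W Y : Type} [AddCommGroup V] [Module ℂ V] [AddCommGroup W] [Module ℂ W]
  [AddCommGroup Y] [Module ℂ Y]

/-- The `1 × 1` matrix of an isomorphism of complex lines in the given coordinates. -/
def coeff (f : W ≃ₗ[ℂ] ℂ) (A : V ≃ₗ[ℂ] W) (e : V ≃ₗ[ℂ] ℂ) : ℂ := f (A (e.symm 1))

theorem apply_eq_coeff_mul (f : W ≃ₗ[ℂ] ℂ) (A : V ≃ₗ[ℂ] W) (e : V ≃ₗ[ℂ] ℂ) (v : V) :
    f (A v) = coeff f A e * e v := by
  have h : v = e v • e.symm 1 := by rw [← map_smul]; simp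
  conv_lhs => rw [h]
  simp [coeff, mul_comm]

theorem coeff_trans (f : Y ≃ₗ[ℂ] ℂ) (B : W ≃ₗ[ℂ] Y) (e' : W ≃ₗ[ℂ] ℂ) (A : V ≃ₗ[ℂ] W)
    (e : V ≃ₗ[ℂ] ℂ) : coeff f (A.trans B) e = coeff f B e' * coeff e' A e := by
  simpa [coeff] using apply_eq_coeff_mul f B e' (A (e.symm 1))

theorem coeff_ne_zero (f : W ≃ₗ[ℂ] ℂ) (A : V ≃ₗ[ℂ] W) (e : V ≃ₗ[ℂ] ℂ) : coeff f A e ≠ 0 := by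
  simp [coeff]

theorem coeff_symm (f : W ≃ₗ[ℂ] ℂ) (A : V ≃ₗ[ℂ] W) (e : V ≃ₗ[ℂ] ℂ) :
    coeff e A.symm f = (coeff f A e)⁻¹ := by
  have h := coeff_trans e A.symm f A e
  rw [LinearEquiv.self_trans_symm] at h
  have h1 : coeff e (LinearEquiv.refl ℂ V) e = 1 := by simp [coeff]
  rw [h1] at h
  exact eq_inv_of_mul_eq_one_left h.symm

/-- The coordinate on a tensor product of lines induced by coordinates on the factors. -/
def tensorCoord (e : V ≃ₗ[ℂ] ℂ) (e' : W ≃ₗ[ℂ] ℂ) : (V ⊗[ℂ] W) ≃ₗ[ℂ] ℂ :=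
  (TensorProduct.congr e e').trans (TensorProduct.lid ℂ ℂ)

@[simp] theorem tensorCoord_tmul (e : V ≃ₗ[ℂ] ℂ) (e' : W ≃ₗ[ℂ] ℂ) (v : V) (w : W) :
    tensorCoord e e' (v ⊗ₜ w) = e v * e' w := by simp [tensorCoord]

theorem tensorCoord_symm_one (e : V ≃ₗ[ℂ] ℂ) (e' : W ≃ₗ[ℂ] ℂ) :
    (tensorCoord e e').symm 1 = e.symm 1 ⊗ₜ e'.symm 1 := by
  rw [LinearEquiv.symm_apply_eq]; simp

theorem coeff_tensor {V' W' : Type} [AddCommGroup V'] [Module ℂ V'] [AddCommGroup W'] [Module ℂ W']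
    (f : W ≃ₗ[ℂ] ℂ) (A : V ≃ₗ[ℂ] W) (e : V ≃ₗ[ℂ] ℂ)
    (f' : W' ≃ₗ[ℂ] ℂ) (A' : V' ≃ₗ[ℂ] W') (e' : V' ≃ₗ[ℂ] ℂ) :
    coeff (tensorCoord f f') (TensorProduct.congr A A') (tensorCoord e e') =
      coeff f A e * coeff f' A' e' := by
  simp [coeff, tensorCoord_symm_one]

/-- The coordinate on the dual line induced by a coordinate on the line. -/
def dualCoord (e : V ≃ₗ[ℂ] ℂ) : Module.Dual ℂ V ≃ₗ[ℂ] ℂ :=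
  e.symm.dualMap.trans (LinearMap.ringLmapEquivSelf ℂ ℂ ℂ)

@[simp] theorem dualCoord_apply (e : V ≃ₗ[ℂ] ℂ) (ξ : Module.Dual ℂ V) :
    dualCoord e ξ = ξ (e.symm 1) := by simp [dualCoord]

theorem dualCoord_symm_one (e : V ≃ₗ[ℂ] ℂ) : (dualCoord e).symm 1 = e.toLinearMap := by
  rw [LinearEquiv.symm_apply_eq, dualCoord_apply]; simp

theorem coeff_dual (f : W ≃ₗ[ℂ] ℂ) (A : V ≃ₗ[ℂ] W) (e : V ≃ₗ[ℂ] ℂ) :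
    coeff (dualCoord f) A.symm.dualMap (dualCoord e) = (coeff f A e)⁻¹ := by
  rw [← coeff_symm]
  simp [coeff, dualCoord_symm_one]

theorem contractLeft_eq (e : V ≃ₗ[ℂ] ℂ) :
    contractLeft ℂ V = (tensorCoord (dualCoord e) e).toLinearMap := by
  refine TensorProduct.ext' fun ξ v => ?_
  have h : ξ v = e v * ξ (e.symm 1) := by
    rw [← smul_eq_mul, ← map_smul, ← map_smul]; simp
  simp [h, mul_comm]

/-- The evaluation pairing `V^* ⊗ V ≃ ℂ` of a line. -/
def contractEquiv (e : V ≃ₗ[ℂ] ℂ) : (Module.Dual ℂ V ⊗[ℂ] V) ≃ₗ[ℂ] ℂ :=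
  LinearEquiv.ofBijective (contractLeft ℂ V) (by
    rw [contractLeft_eq e]; exact (tensorCoord (dualCoord e) e).bijective)

@[simp] theorem contractEquiv_tmul (e : V ≃ₗ[ℂ] ℂ) (ξ : Module.Dual ℂ V) (v : V) :
    contractEquiv e (ξ ⊗ₜ v) = ξ v := by simp [contractEquiv]

theorem coeff_comm (f e : V ≃ₗ[ℂ] ℂ) (f' e' : W ≃ₗ[ℂ] ℂ) :
    coeff (tensorCoord f' f) (TensorProduct.comm ℂ V W) (tensorCoord e e') =
      coeff f (LinearEquiv.refl ℂ V) e * coeff f' (LinearEquiv.refl ℂ W) e' := by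
  simp [coeff, tensorCoord_symm_one, mul_comm]

theorem coeff_assoc (f e : V ≃ₗ[ℂ] ℂ) (f' e' : W ≃ₗ[ℂ] ℂ) (f'' e'' : Y ≃ₗ[ℂ] ℂ) :
    coeff (tensorCoord f (tensorCoord f' f'')) (TensorProduct.assoc ℂ V W Y)
      (tensorCoord (tensorCoord e e') e'') =
      coeff f (LinearEquiv.refl ℂ V) e * coeff f' (LinearEquiv.refl ℂ W) e' *
        coeff f'' (LinearEquiv.refl ℂ Y) e'' := by
  simp [coeff, tensorCoord_symm_one, mul_assoc]

theorem coeff_lid (f e : V ≃ₗ[ℂ] ℂ) :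
    coeff f (TensorProduct.lid ℂ V) (tensorCoord (LinearEquiv.refl ℂ ℂ) e) =
      coeff f (LinearEquiv.refl ℂ V) e := by
  simp [coeff, tensorCoord_symm_one]

theorem coeff_contract (e₀ e e' : V ≃ₗ[ℂ] ℂ) :
    coeff (LinearEquiv.refl ℂ ℂ) (contractEquiv e₀) (tensorCoord (dualCoord e) e') =
      coeff e (LinearEquiv.refl ℂ V) e' := by
  simp [coeff, tensorCoord_symm_one, dualCoord_symm_one]

theorem tensor_square {V₁ V₂ V₃ V₄ W₁ W₂ W₃ W₄ : Type}
    [AddCommGroup V₁] [Module ℂ V₁] [AddCommGroup V₂] [Module ℂ V₂]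
    [AddCommGroup V₃] [Module ℂ V₃] [AddCommGroup V₄] [Module ℂ V₄]
    [AddCommGroup W₁] [Module ℂ W₁] [AddCommGroup W₂] [Module ℂ W₂]
    [AddCommGroup W₃] [Module ℂ W₃] [AddCommGroup W₄] [Module ℂ W₄]
    {A : V₁ ≃ₗ[ℂ] V₂} {B : V₂ ≃ₗ[ℂ] V₄} {C : V₁ ≃ₗ[ℂ] V₃} {D : V₃ ≃ₗ[ℂ] V₄}
    {A' : W₁ ≃ₗ[ℂ] W₂} {B' : W₂ ≃ₗ[ℂ] W₄} {C' : W₁ ≃ₗ[ℂ] W₃} {D' : W₃ ≃ₗ[ℂ] W₄}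
    (h : ∀ x, B (A x) = D (C x)) (h' : ∀ x, B' (A' x) = D' (C' x)) (v : V₁ ⊗[ℂ] W₁) :
    TensorProduct.congr B B' (TensorProduct.congr A A' v) =
      TensorProduct.congr D D' (TensorProduct.congr C C' v) := by
  induction v with
  | zero => simp
  | add x y hx hy => simp only [map_add, hx, hy]
  | tmul x y => simp [h, h']

theorem dual_square {V₁ V₂ V₃ V₄ : Type}
    [AddCommGroup V₁] [Module ℂ V₁] [AddCommGroup V₂] [Module ℂ V₂]
    [AddCommGroup V₃] [Module ℂ V₃] [AddCommGroup V₄] [Module ℂ V₄]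
    {A : V₁ ≃ₗ[ℂ] V₂} {B : V₂ ≃ₗ[ℂ] V₄} {C : V₁ ≃ₗ[ℂ] V₃} {D : V₃ ≃ₗ[ℂ] V₄}
    (h : ∀ x, B (A x) = D (C x)) (ξ : Module.Dual ℂ V₁) :
    B.symm.dualMap (A.symm.dualMap ξ) = D.symm.dualMap (C.symm.dualMap ξ) := by
  ext v
  simp only [LinearEquiv.dualMap_apply]
  congr 1
  rw [LinearEquiv.symm_apply_eq, LinearEquiv.symm_apply_eq, h]
  simp

theorem comm_square {V' W' : Type} [AddCommGroup V'] [Module ℂ V'] [AddCommGroup W'] [Module ℂ W']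
    (A : V ≃ₗ[ℂ] V') (B : W ≃ₗ[ℂ] W') (v : V ⊗[ℂ] W) :
    TensorProduct.comm ℂ V' W' (TensorProduct.congr A B v) =
      TensorProduct.congr B A (TensorProduct.comm ℂ V W v) := by
  induction v with
  | zero => simp
  | add x y hx hy => simp only [map_add, hx, hy]
  | tmul x y => simp

theorem assoc_square {V' W' Y' : Type} [AddCommGroup V'] [Module ℂ V'] [AddCommGroup W']
    [Module ℂ W'] [AddCommGroup Y'] [Module ℂ Y']
    (A : V ≃ₗ[ℂ] V') (B : W ≃ₗ[ℂ] W') (C : Y ≃ₗ[ℂ] Y') (v : (V ⊗[ℂ] W) ⊗[ℂ] Y) :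
    TensorProduct.assoc ℂ V' W' Y' (TensorProduct.congr (TensorProduct.congr A B) C v) =
      TensorProduct.congr A (TensorProduct.congr B C) (TensorProduct.assoc ℂ V W Y v) := by
  induction v with
  | zero => simp
  | add x y hx hy => simp only [map_add, hx, hy]
  | tmul x y =>
    induction x with
    | zero => simp
    | add x x' hx hy => simp only [TensorProduct.add_tmul, map_add, hx, hy]
    | tmul x x' => simp

theorem lid_square (A : V ≃ₗ[ℂ] W) (v : ℂ ⊗[ℂ] V) :
    TensorProduct.lid ℂ W (TensorProduct.congr (LinearEquiv.refl ℂ ℂ) A v) =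
      A (TensorProduct.lid ℂ V v) := by
  induction v with
  | zero => simp
  | add x y hx hy => simp only [map_add, hx, hy]
  | tmul x y => simp

theorem contract_square (A : V ≃ₗ[ℂ] W) (e : V ≃ₗ[ℂ] ℂ) (f : W ≃ₗ[ℂ] ℂ)
    (v : Module.Dual ℂ V ⊗[ℂ] V) :
    contractEquiv f (TensorProduct.congr A.symm.dualMap A v) = contractEquiv e v := by
  induction v with
  | zero => simp
  | add x y hx hy => simp only [map_add, hx, hy]
  | tmul x y => simp

end Lines

/-! ### Holomorphic line bundles and linearizations -/

/-- A holomorphic line bundle on `X`: a family of complex lines, with local trivializations over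
the members of an open cover whose transition functions are holomorphic. The values of `triv i`
outside `U i` are irrelevant. -/
structure HolLineBundle {N : ℕ} (X : Set (ProjSpace N)) where
  Fiber : X → Type
  [addCommGroup : ∀ m, AddCommGroup (Fiber m)]
  [module : ∀ m, Module ℂ (Fiber m)]
  ι : Type
  U : ι → Set X
  isOpen_U : ∀ i, IsOpen (U i)
  cover : ∀ m, ∃ i, m ∈ U i
  triv : ι → ∀ m, Fiber m ≃ₗ[ℂ] ℂ
  transition : ∀ i j, ∀ m ∈ U i ∩ U j,
    HolAt (fun q => coeff (triv i q) (LinearEquiv.refl ℂ (Fiber q)) (triv j q)) m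

attribute [instance] HolLineBundle.addCommGroup HolLineBundle.module

/-- A `G`-linearized line bundle on `X`: a holomorphic line bundle `L` with a lift of the action of
`G` to an action on `L` by linear isomorphisms `lift g : L_m → L_{g m}` of the fibres. In local
trivializations the lift is continuous on `G × X`, and holomorphic on `X` for every fixed
element of `G`. -/
structure GLineBundle (G : Type*) [Group G] [TopologicalSpace G] {N : ℕ} (X : Set (ProjSpace N))
    [MulAction G X] extends HolLineBundle X where
  lift : ∀ (g : G) (m m' : X), g • m = m' → (Fiber m ≃ₗ[ℂ] Fiber m')
  lift_one : ∀ (m : X) (v : Fiber m), lift 1 m m (one_smul G m) v = v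
  lift_mul : ∀ (g h : G) (m m' m'' : X) (hh : h • m = m') (hg : g • m' = m'') (v : Fiber m),
    lift (g * h) m m'' (by rw [mul_smul, hh, hg]) v = lift g m' m'' hg (lift h m m' hh v)
  lift_continuous : ∀ i j, ContinuousOn
    (fun x : G × X => coeff (triv i (x.1 • x.2)) (lift x.1 x.2 (x.1 • x.2) rfl) (triv j x.2))
    {x : G × X | x.2 ∈ U j ∧ x.1 • x.2 ∈ U i}
  lift_holomorphic : ∀ i j (g : G) (m : X), m ∈ U j → g • m ∈ U i →
    HolAt (fun q => coeff (triv i (g • q)) (lift g q (g • q) rfl) (triv j q)) m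

section Bundles

variable {G : Type*} [Group G] [TopologicalSpace G] {N : ℕ} {X : Set (ProjSpace N)} [MulAction G X]

/-- An isomorphism of `G`-linearized line bundles: fibrewise linear, holomorphic, equivariant. -/
structure GIso (L L' : GLineBundle G X) where
  map : ∀ m, L.Fiber m ≃ₗ[ℂ] L'.Fiber m
  holomorphic : ∀ i j, ∀ m, m ∈ L'.U i → m ∈ L.U j →
    HolAt (fun q => coeff (L'.triv i q) (map q) (L.triv j q)) m
  equivariant : ∀ (g : G) (m m' : X) (h : g • m = m') (v : L.Fiber m),
    map m' (L.lift g m m' h v) = L'.lift g m m' h (map m v)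

def GIso.refl (L : GLineBundle G X) : GIso L L where
  map m := LinearEquiv.refl ℂ _
  holomorphic i j m hi hj := L.transition i j m ⟨hi, hj⟩
  equivariant _ _ _ _ _ := rfl

def GIso.symm {L L' : GLineBundle G X} (a : GIso L L') : GIso L' L where
  map m := (a.map m).symm
  holomorphic i j m hi hj := by
    simp only [coeff_symm]
    exact (a.holomorphic j i m hj hi).inv (coeff_ne_zero _ _ _)
  equivariant g m m' h v := by
    rw [LinearEquiv.symm_apply_eq, a.equivariant, LinearEquiv.apply_symm_apply]

def GIso.trans {L L' L'' : GLineBundle G X} (a : GIso L L') (b : GIso L' L'') : GIso L L'' where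
  map m := (a.map m).trans (b.map m)
  holomorphic i j m hi hj := by
    obtain ⟨k, hk⟩ := L'.cover m
    simp only [fun q => coeff_trans (L''.triv i q) (b.map q) (L'.triv k q) (a.map q) (L.triv j q)]
    exact (b.holomorphic i k m hi hk).mul (a.holomorphic k j m hk hj)
  equivariant g m m' h v := by simp [a.equivariant, b.equivariant]

/-- The trivial line bundle with the trivial linearization. -/
def trivialBundle (G : Type*) [Group G] [TopologicalSpace G] {N : ℕ} (X : Set (ProjSpace N))
    [MulAction G X] : GLineBundle G X where
  Fiber _ := ℂ
  ι := Unit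
  U _ := Set.univ
  isOpen_U _ := isOpen_univ
  cover _ := ⟨(), trivial⟩
  triv _ _ := LinearEquiv.refl ℂ ℂ
  transition _ _ _ _ := HolAt.const 1
  lift _ _ _ _ := LinearEquiv.refl ℂ ℂ
  lift_one _ _ := rfl
  lift_mul _ _ _ _ _ _ _ _ := rfl
  lift_continuous _ _ := continuousOn_const
  lift_holomorphic _ _ _ _ _ _ := HolAt.const 1

/-- The tensor product of `G`-linearized line bundles. -/
def tensorBundle (L L' : GLineBundle G X) : GLineBundle G X where
  Fiber m := L.Fiber m ⊗[ℂ] L'.Fiber m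
  ι := L.ι × L'.ι
  U i := L.U i.1 ∩ L'.U i.2
  isOpen_U i := (L.isOpen_U i.1).inter (L'.isOpen_U i.2)
  cover m := by
    obtain ⟨i, hi⟩ := L.cover m
    obtain ⟨j, hj⟩ := L'.cover m
    exact ⟨(i, j), hi, hj⟩
  triv i m := tensorCoord (L.triv i.1 m) (L'.triv i.2 m)
  transition i j m hm := by
    simp only [← TensorProduct.congr_refl_refl, coeff_tensor]
    exact (L.transition i.1 j.1 m ⟨hm.1.1, hm.2.1⟩).mul (L'.transition i.2 j.2 m ⟨hm.1.2, hm.2.2⟩)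
  lift g m m' h := TensorProduct.congr (L.lift g m m' h) (L'.lift g m m' h)
  lift_one _ v := by
    induction v with
    | zero => simp
    | add x y hx hy => rw [map_add, hx, hy]
    | tmul x y => simp [L.lift_one, L'.lift_one]
  lift_mul g h m m' m'' hh hg v := by
    induction v with
    | zero => simp
    | add x y hx hy => simp only [map_add, hx, hy]
    | tmul x y => simp [L.lift_mul g h m m' m'' hh hg, L'.lift_mul g h m m' m'' hh hg]
  lift_continuous i j := by
    simp only [coeff_tensor]
    exact ((L.lift_continuous i.1 j.1).mono fun x hx => ⟨hx.1.1, hx.2.1⟩).mul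
      ((L'.lift_continuous i.2 j.2).mono fun x hx => ⟨hx.1.2, hx.2.2⟩)
  lift_holomorphic i j g m hj hi := by
    simp only [coeff_tensor]
    exact (L.lift_holomorphic i.1 j.1 g m hj.1 hi.1).mul
      (L'.lift_holomorphic i.2 j.2 g m hj.2 hi.2)

/-- The dual of a `G`-linearized line bundle. -/
def dualBundle (L : GLineBundle G X) : GLineBundle G X where
  Fiber m := Module.Dual ℂ (L.Fiber m)
  ι := L.ι
  U := L.U
  isOpen_U := L.isOpen_U
  cover := L.cover
  triv i m := dualCoord (L.triv i m)
  transition i j m hm := by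
    have h := (L.transition i j m hm).inv (coeff_ne_zero _ _ _)
    simp only [← coeff_dual] at h
    exact h
  lift g m m' h := (L.lift g m m' h).symm.dualMap
  lift_one m ξ := by
    ext v
    simp only [LinearEquiv.dualMap_apply]
    congr 1
    rw [LinearEquiv.symm_apply_eq, L.lift_one]
  lift_mul g h m m' m'' hh hg ξ := by
    ext v
    simp only [LinearEquiv.dualMap_apply]
    congr 1
    rw [LinearEquiv.symm_apply_eq, L.lift_mul g h m m' m'' hh hg]
    simp
  lift_continuous i j := by
    simp only [coeff_dual]
    exact (L.lift_continuous i j).inv₀ fun _ _ => coeff_ne_zero _ _ _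
  lift_holomorphic i j g m hj hi := by
    simp only [coeff_dual]
    exact (L.lift_holomorphic i j g m hj hi).inv (coeff_ne_zero _ _ _)

def GIso.tensor {L₁ L₁' L₂ L₂' : GLineBundle G X} (a : GIso L₁ L₁') (b : GIso L₂ L₂') :
    GIso (tensorBundle L₁ L₂) (tensorBundle L₁' L₂') where
  map m := TensorProduct.congr (a.map m) (b.map m)
  holomorphic i j m hi hj := by
    have h := (a.holomorphic i.1 j.1 m hi.1 hj.1).mul (b.holomorphic i.2 j.2 m hi.2 hj.2)
    exact h.of_eq fun q => coeff_tensor _ _ _ _ _ _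
  equivariant g m m' h := tensor_square (a.equivariant g m m' h) (b.equivariant g m m' h)

def GIso.dual {L L' : GLineBundle G X} (a : GIso L L') : GIso (dualBundle L) (dualBundle L') where
  map m := (a.map m).symm.dualMap
  holomorphic i j m hi hj := by
    exact ((a.holomorphic i j m hi hj).inv (coeff_ne_zero _ _ _)).of_eq fun q => coeff_dual _ _ _
  equivariant g m m' h := dual_square (a.equivariant g m m' h)

def GIso.comm (L L' : GLineBundle G X) : GIso (tensorBundle L L') (tensorBundle L' L) where
  map m := TensorProduct.comm ℂ _ _
  holomorphic i j m hi hj := by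
    have h := (L.transition i.2 j.1 m ⟨hi.2, hj.1⟩).mul (L'.transition i.1 j.2 m ⟨hi.1, hj.2⟩)
    exact h.of_eq fun q => coeff_comm _ _ _ _
  equivariant g m m' h := comm_square _ _

def GIso.assoc (L L' L'' : GLineBundle G X) :
    GIso (tensorBundle (tensorBundle L L') L'') (tensorBundle L (tensorBundle L' L'')) where
  map m := TensorProduct.assoc ℂ _ _ _
  holomorphic i j m hi hj := by
    have h := ((L.transition i.1 j.1.1 m ⟨hi.1, hj.1.1⟩).mul
      (L'.transition i.2.1 j.1.2 m ⟨hi.2.1, hj.1.2⟩)).mul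
      (L''.transition i.2.2 j.2 m ⟨hi.2.2, hj.2⟩)
    exact h.of_eq fun q => coeff_assoc _ _ _ _ _ _
  equivariant g m m' h := assoc_square _ _ _

def GIso.oneTensor (L : GLineBundle G X) : GIso (tensorBundle (trivialBundle G X) L) L where
  map m := TensorProduct.lid ℂ _
  holomorphic i j m hi hj := by
    have h := L.transition i j.2 m ⟨hi, hj.2⟩
    exact h.of_eq fun q => coeff_lid _ _
  equivariant g m m' h := lid_square _

def GIso.dualTensor (L : GLineBundle G X) :
    GIso (tensorBundle (dualBundle L) L) (trivialBundle G X) where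
  map m := (contractEquiv (L.triv (L.cover m).choose m) :)
  holomorphic i j m hi hj := by
    have h := (L.transition j.1 j.2 m ⟨hj.1, hj.2⟩)
    exact h.of_eq fun q => coeff_contract _ _ _
  equivariant g m m' h := contract_square (L.lift g m m' h)
    (L.triv (L.cover m).choose m) (L.triv (L.cover m').choose m')

/-! ### The group of `G`-linearized line bundles -/

instance picSetoid (G : Type*) [Group G] [TopologicalSpace G] {N : ℕ} (X : Set (ProjSpace N))
    [MulAction G X] : Setoid (GLineBundle G X) where
  r L L' := Nonempty (GIso L L')
  iseqv := ⟨fun L => ⟨GIso.refl L⟩, fun ⟨a⟩ => ⟨a.symm⟩, fun ⟨a⟩ ⟨b⟩ => ⟨a.trans b⟩⟩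

/-- `Pic^G(X)`: isomorphism classes of `G`-linearized line bundles on `X`. -/
def PicG (G : Type*) [Group G] [TopologicalSpace G] {N : ℕ} (X : Set (ProjSpace N))
    [MulAction G X] := Quotient (picSetoid G X)

/-- The group law of `Pic^G(X)` is the tensor product. -/
instance : CommGroup (PicG G X) where
  mul := Quotient.map₂ tensorBundle fun _ _ ⟨a⟩ _ _ ⟨b⟩ => ⟨a.tensor b⟩
  one := Quotient.mk _ (trivialBundle G X)
  inv := Quotient.map dualBundle fun _ _ ⟨a⟩ => ⟨a.dual⟩
  mul_assoc := by
    rintro ⟨L⟩ ⟨L'⟩ ⟨L''⟩; exact Quotient.sound ⟨GIso.assoc L L' L''⟩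
  one_mul := by rintro ⟨L⟩; exact Quotient.sound ⟨GIso.oneTensor L⟩
  mul_one := by
    rintro ⟨L⟩; exact Quotient.sound ⟨(GIso.comm _ _).trans (GIso.oneTensor L)⟩
  inv_mul_cancel := by rintro ⟨L⟩; exact Quotient.sound ⟨GIso.dualTensor L⟩
  mul_comm := by rintro ⟨L⟩ ⟨L'⟩; exact Quotient.sound ⟨GIso.comm L L'⟩

/-! ### Sections and the equivariant volume -/

/-- `H⁰(X, L)`: the holomorphic sections of `L`. -/
def H0 (L : HolLineBundle X) : Submodule ℂ (∀ m, L.Fiber m) where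
  carrier := {s | ∀ i, ∀ m ∈ L.U i, HolAt (fun q => L.triv i q (s q)) m}
  zero_mem' i m _ := by simpa using HolAt.const 0
  add_mem' hs ht i m hm := by simpa using (hs i m hm).add (ht i m hm)
  smul_mem' c s hs i m hm := by simpa using (HolAt.const c).mul (hs i m hm)

theorem GLineBundle.lift_mem_H0 [HolomorphicAction G X] (L : GLineBundle G X) (g : G)
    {s : ∀ m, L.Fiber m} (hs : s ∈ H0 L.toHolLineBundle) :
    (fun m => L.lift g (g⁻¹ • m) m (smul_inv_smul g m) (s (g⁻¹ • m))) ∈ H0 L.toHolLineBundle := by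
  intro i m hm
  obtain ⟨j, hj⟩ := L.cover (g⁻¹ • m)
  have h1 := (L.lift_holomorphic i j g (g⁻¹ • m) hj (by rwa [smul_inv_smul])).mul (hs j _ hj)
  simp only [← apply_eq_coeff_mul] at h1
  have h2 := (HolomorphicAction.holomorphic (X := X) g⁻¹).pullback m _ h1
  have key : ∀ (m₁ m₂ : X) (v : L.Fiber m₁) (h : g • m₁ = m₂),
      L.triv i (g • m₁) (L.lift g m₁ (g • m₁) rfl v) = L.triv i m₂ (L.lift g m₁ m₂ h v) := by
    rintro m₁ _ v rfl; rfl
  convert h2 using 2 with q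
  exact (key _ _ _ _).symm

/-- The action of `G` on `H⁰(X, L)`: `(g · s)(m) = g · s(g⁻¹ m)`. -/
def sectionRep [HolomorphicAction G X] (L : GLineBundle G X) :
    Representation ℂ G (H0 L.toHolLineBundle) where
  toFun g :=
    { toFun := fun s => ⟨_, L.lift_mem_H0 g s.2⟩
      map_add' := fun s t => by ext m; simp
      map_smul' := fun c s => by ext m; simp }
  map_one' := by
    ext s m
    have key : ∀ (m₁ : X) (h : m₁ = m) (h' : (1 : G) • m₁ = m),
        L.lift 1 m₁ m h' (s.1 m₁) = s.1 m := by
      rintro _ rfl h'; exact L.lift_one _ _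
    exact key _ (by simp) _
  map_mul' g h := by
    ext s m
    have key : ∀ (m₁ m₂ : X) (e : m₁ = m₂) (h₁ : (g * h) • m₁ = m) (h₂ : (g * h) • m₂ = m),
        L.lift (g * h) m₁ m h₁ (s.1 m₁) = L.lift (g * h) m₂ m h₂ (s.1 m₂) := by
      rintro _ _ rfl _ _; rfl
    refine (key _ (h⁻¹ • g⁻¹ • m) (by simp [mul_smul]) _ (by simp [mul_smul])).trans ?_
    exact L.lift_mul g h _ _ _ _ _ _

/-- `dim H⁰(X, L)_0`, the dimension of the isotypic component of the trivial representation in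
`H⁰(X, L)`, which is the space `H⁰(X, L)^G` of invariant sections. -/
def h0InvBundle [HolomorphicAction G X] (L : GLineBundle G X) : ℕ∞ :=
  Cardinal.toENat (Module.rank ℂ (sectionRep L).invariants)

theorem h0InvBundle_le [HolomorphicAction G X] {L L' : GLineBundle G X} (a : GIso L L') :
    h0InvBundle L ≤ h0InvBundle L' := by
  have hmem : ∀ s ∈ H0 L.toHolLineBundle, (fun m => a.map m (s m)) ∈ H0 L'.toHolLineBundle := by
    intro s hs i m hm
    obtain ⟨j, hj⟩ := L.cover m
    have h := (a.holomorphic i j m hm hj).mul (hs j m hj)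
    simpa only [← apply_eq_coeff_mul] using h
  let T : H0 L.toHolLineBundle →ₗ[ℂ] H0 L'.toHolLineBundle :=
    { toFun := fun s => ⟨_, hmem s.1 s.2⟩
      map_add' := fun s t => by ext m; simp
      map_smul' := fun c s => by ext m; simp }
  have hinv : ∀ s ∈ (sectionRep L).invariants, T s ∈ (sectionRep L').invariants := by
    intro s hs g
    have hs' := hs g
    ext m
    have h1 : L.lift g (g⁻¹ • m) m (smul_inv_smul g m) (s.1 (g⁻¹ • m)) = s.1 m :=
      congrFun (congrArg Subtype.val hs') m
    change L'.lift g (g⁻¹ • m) m (smul_inv_smul g m) (a.map _ (s.1 (g⁻¹ • m))) = a.map m (s.1 m)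
    rw [← a.equivariant, h1]
  refine Cardinal.toENat.monotone' (LinearMap.rank_le_of_injective (T.restrict hinv) ?_)
  intro s t hst
  ext m
  have h := congrFun (congrArg (fun x => x.1.1) hst) m
  exact (a.map m).injective h

/-- `dim H⁰(X, L)_0` for `L ∈ Pic^G(X)`. -/
def h0Inv [HolomorphicAction G X] : PicG G X → ℕ∞ :=
  Quotient.lift h0InvBundle fun _ _ ⟨a⟩ => le_antisymm (h0InvBundle_le a) (h0InvBundle_le a.symm)

/-- The invariant-part volume `vol_0(L) = limsup_k (n - g)! / k^(n - g) · dim H⁰(X, L^k)_0`, with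
values in `[0, ∞]`, for an `n`-dimensional variety, a `g`-dimensional group, and `g ≤ n`. -/
def vol0 [HolomorphicAction G X] (n g : ℕ) (L : PicG G X) : ℝ≥0∞ :=
  limsup (fun k : ℕ => ((n - g)! : ℝ≥0∞) / (k : ℝ≥0∞) ^ (n - g) * (h0Inv (L ^ k) : ℝ≥0∞)) atTop

/-- The class of `L` in `(Pic^G(X) / P) ⊗ ℚ`. -/
def ratClass (P : Subgroup (PicG G X)) (L : PicG G X) : ℚ ⊗[ℤ] Additive (PicG G X ⧸ P) :=
  1 ⊗ₜ Additive.ofMul (QuotientGroup.mk L)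

end Bundles

end EquivVol

end

/-!
The invariant sections of the powers of a linearized line bundle `L` multiply: the product of
invariant sections of `L` and `L'` is an invariant section of `L ⊗ L'`. Zero loci of holomorphic
sections are closed analytic subsets, so on an irreducible variety a product of nonzero sections is
nonzero. Hence multiplication by a fixed nonzero invariant section is injective, and
`a k = dim H⁰(M, L^k)_0` satisfies `a k ≤ a (k + m)` whenever `a m ≠ 0`
(`h0Inv_le_mul`).

Homogeneity of `vol0` follows from this property of `a` alone (`limsup_homogeneous`). The sequence
`k ↦ a (q k) / k ^ d` is `q ^ d` times the restriction of `k ↦ a k / k ^ d` to the multiples of `q`,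
so the point is that the upper limit does not change on restriction to multiples of `q`. If `a k₀`
is nonzero, then `a k ≤ a (k + (q - 1) k₀)`, and `k + (q - 1) k₀` is divisible by `q` for every
`k ≡ k₀` modulo `q`. Thus each residue class modulo `q` is dominated, up to a bounded shift, by the
class of `0`, and bounded shifts do not matter in the limit.

Finally, `ℚ ⊗ A` is the localization of the abelian group `A` at the nonzero integers: each of its
elements is `(1 / m) • (1 ⊗ a)` with `m > 0`, and `1 ⊗ a = 1 ⊗ b` only if `t a = t b` for some
`t > 0`. So a function on `A` which is homogeneous of degree `d` under positive integers extends
uniquely to a function on `ℚ ⊗ A` homogeneous of degree `d` under positive rationals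
(`existsUnique_homogeneous_extension`).
-/

noncomputable section

namespace EquivVol

/-! ### Products of invariant sections -/

section Sections

variable {G : Type*} [Group G] [TopologicalSpace G] {N : ℕ} {X : Set (ProjSpace N)} [MulAction G X]

theorem isAnalyticSubset_zeroLocus {L : HolLineBundle X} {s : ∀ m, L.Fiber m} (hs : s ∈ H0 L) :
    IsAnalyticSubset {m | s m = 0} := by
  intro p
  obtain ⟨i, hi⟩ := L.cover p
  exact ⟨1, fun _ q => L.triv i q (s q), fun _ => hs i p hi, Eventually.of_forall fun q => by simp⟩

theorem tmul_mem_H0 {L L' : GLineBundle G X} {s : ∀ m, L.Fiber m} {t : ∀ m, L'.Fiber m}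
    (hs : s ∈ H0 L.toHolLineBundle) (ht : t ∈ H0 L'.toHolLineBundle) :
    (fun m => s m ⊗ₜ[ℂ] t m : ∀ m, (tensorBundle L L').Fiber m) ∈
      H0 (tensorBundle L L').toHolLineBundle := by
  intro i m hm
  exact ((hs i.1 m hm.1).mul (ht i.2 m hm.2)).of_eq fun q => tensorCoord_tmul _ _ _ _

/-- Multiplication by a holomorphic section of `L'`. -/
def mulSection (L : GLineBundle G X) {L' : GLineBundle G X} (t : H0 L'.toHolLineBundle) :
    H0 L.toHolLineBundle →ₗ[ℂ] H0 (tensorBundle L L').toHolLineBundle where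
  toFun s := ⟨_, tmul_mem_H0 s.2 t.2⟩
  map_add' s s' := by
    ext m
    exact TensorProduct.add_tmul (s.1 m) (s'.1 m) (t.1 m)
  map_smul' c s := by
    ext m
    exact (TensorProduct.smul_tmul' c (s.1 m) (t.1 m)).symm

/-- Irreducibility of the variety makes multiplication by a nonzero section injective. -/
theorem mulSection_injective (hX : IsProjectiveVariety X) (L : GLineBundle G X)
    {L' : GLineBundle G X} {t : H0 L'.toHolLineBundle} (ht : t ≠ 0) :
    Function.Injective (mulSection L t) := by
  rw [injective_iff_map_eq_zero]
  intro s hst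
  have hcover : {m | s.1 m = 0} ∪ {m | t.1 m = 0} = Set.univ := by
    refine Set.eq_univ_of_forall fun m => ?_
    obtain ⟨i, -⟩ := L.cover m
    obtain ⟨j, -⟩ := L'.cover m
    have h0 : s.1 m ⊗ₜ[ℂ] t.1 m = 0 := congrFun (congrArg Subtype.val hst) m
    have h1 := tensorCoord_tmul (L.triv i m) (L'.triv j m) (s.1 m) (t.1 m)
    rw [h0, map_zero, zero_eq_mul] at h1
    simpa using h1
  rcases hX.irreducible _ _ (isAnalyticSubset_zeroLocus s.2) (isAnalyticSubset_zeroLocus t.2)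
    hcover with h | h
  · ext m
    exact Set.eq_univ_iff_forall.1 h m
  · refine absurd ?_ ht
    ext m
    exact Set.eq_univ_iff_forall.1 h m

variable [HolomorphicAction G X]

theorem mulSection_mem_invariants {L L' : GLineBundle G X} {s : H0 L.toHolLineBundle}
    {t : H0 L'.toHolLineBundle} (hs : s ∈ (sectionRep L).invariants)
    (ht : t ∈ (sectionRep L').invariants) :
    mulSection L t s ∈ (sectionRep (tensorBundle L L')).invariants := by
  intro g
  ext m
  have h1 : L.lift g (g⁻¹ • m) m (smul_inv_smul g m) (s.1 (g⁻¹ • m)) = s.1 m :=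
    congrFun (congrArg Subtype.val (hs g)) m
  have h2 : L'.lift g (g⁻¹ • m) m (smul_inv_smul g m) (t.1 (g⁻¹ • m)) = t.1 m :=
    congrFun (congrArg Subtype.val (ht g)) m
  exact congrArg₂ (fun v w => v ⊗ₜ[ℂ] w) h1 h2

theorem h0InvBundle_le_tensorBundle (hX : IsProjectiveVariety X) (L : GLineBundle G X)
    {L' : GLineBundle G X} (h : h0InvBundle L' ≠ 0) :
    h0InvBundle L ≤ h0InvBundle (tensorBundle L L') := by
  have hne : (sectionRep L').invariants ≠ ⊥ := by
    intro hbot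
    apply h
    rw [h0InvBundle, hbot, rank_bot, map_zero]
  obtain ⟨t, ht, ht0⟩ := Submodule.exists_mem_ne_zero_of_ne_bot hne
  refine Cardinal.toENat.monotone' (LinearMap.rank_le_of_injective
    ((mulSection L t).restrict fun s hs => mulSection_mem_invariants hs ht) ?_)
  intro s s' hs
  exact Subtype.ext (mulSection_injective hX L ht0 (congrArg Subtype.val hs))

theorem h0Inv_le_mul (hX : IsProjectiveVariety X) (L : PicG G X) {L' : PicG G X}
    (h : h0Inv L' ≠ 0) : h0Inv L ≤ h0Inv (L * L') := by
  induction L using Quotient.inductionOn with | _ L =>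
  induction L' using Quotient.inductionOn with | _ L' =>
  exact h0InvBundle_le_tensorBundle hX L h

end Sections

/-! ### Upper limits along multiples -/

theorem le_apply_add_mul {a : ℕ → ℝ≥0∞} (ha : ∀ k m, a m ≠ 0 → a k ≤ a (k + m)) {m : ℕ}
    (hm : a m ≠ 0) (k j : ℕ) : a k ≤ a (k + j * m) := by
  induction j with
  | zero => simp
  | succ j ih =>
    refine ih.trans ((ha _ m hm).trans_eq ?_)
    congr 1
    ring

/-- Every term is dominated, after a shift bounded independently of the term, by a term whose index
is a multiple of `q`. -/
theorem exists_bounded_shift {a : ℕ → ℝ≥0∞} (ha : ∀ k m, a m ≠ 0 → a k ≤ a (k + m)) {q : ℕ}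
    (hq : 1 ≤ q) : ∃ B : ℕ, ∀ k, ∃ j, k ≤ q * j ∧ q * j ≤ k + B ∧ a k ≤ a (q * j) := by
  have hclass : ∀ r : Fin q, ∃ b : ℕ, ∀ k, k % q = r →
      ∃ j, k ≤ q * j ∧ q * j ≤ k + b ∧ a k ≤ a (q * j) := by
    intro r
    by_cases h : ∃ k₀, k₀ % q = r ∧ a k₀ ≠ 0
    · obtain ⟨k₀, hk₀, h0⟩ := h
      -- Adding `k₀` another `q - 1` times moves the class of `k₀` to that of `0`.
      refine ⟨(q - 1) * k₀, fun k hk => ?_⟩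
      have hdvd : q ∣ k + (q - 1) * k₀ := by
        have hmod : k + (q - 1) * k₀ ≡ k₀ + (q - 1) * k₀ [MOD q] :=
          Nat.ModEq.add_right _ (hk.trans hk₀.symm)
        refine (hmod.dvd_iff dvd_rfl).2 ⟨k₀, ?_⟩
        obtain ⟨p, rfl⟩ := Nat.exists_eq_add_of_le' hq
        simp only [Nat.add_sub_cancel]
        ring
      obtain ⟨j, hj⟩ := hdvd
      refine ⟨j, by omega, by omega, ?_⟩
      rw [← hj]
      exact le_apply_add_mul ha h0 k (q - 1)
    -- In a class on which `a` vanishes, rounding up to a multiple of `q` is enough.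
    · push Not at h
      refine ⟨q, fun k hk => ⟨k / q + 1, ?_, ?_, by simp [h k hk]⟩⟩
      · exact (Nat.lt_mul_div_succ k hq).le
      · have := Nat.mul_div_le k q
        rw [mul_add]
        omega
  choose b hb using hclass
  refine ⟨∑ r, b r, fun k => ?_⟩
  obtain ⟨j, h1, h2, h3⟩ := hb ⟨k % q, Nat.mod_lt _ hq⟩ k rfl
  have hle : b ⟨k % q, Nat.mod_lt _ hq⟩ ≤ ∑ r, b r :=
    Finset.single_le_sum (fun _ _ => Nat.zero_le _) (Finset.mem_univ _)
  exact ⟨j, h1, by omega, h3⟩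

theorem tendsto_one_add_div_pow (B d : ℕ) :
    Tendsto (fun k : ℕ => (1 + (B : ℝ≥0∞) / k) ^ d) atTop (𝓝 1) := by
  have h : Tendsto (fun k : ℕ => (B : ℝ≥0∞) / k) atTop (𝓝 0) :=
    ENNReal.Tendsto.div tendsto_const_nhds (Or.inr (by simp)) ENNReal.tendsto_nat_nhds_top
      (Or.inr (ENNReal.natCast_ne_top B)) |>.trans (by simp)
  have h2 := (tendsto_const_nhds (x := (1 : ℝ≥0∞))).add h
  simpa using ENNReal.Tendsto.pow (n := d) h2

/-- The upper limit of `c / k ^ d * a k` is already attained along the multiples of `q`. -/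
theorem limsup_le_limsup_mul {a : ℕ → ℝ≥0∞} (ha : ∀ k m, a m ≠ 0 → a k ≤ a (k + m)) {q : ℕ}
    (hq : 1 ≤ q) (c : ℝ≥0∞) (d : ℕ) :
    limsup (fun k : ℕ => c / (k : ℝ≥0∞) ^ d * a k) atTop ≤
      limsup (fun k : ℕ => c / ((q * k : ℕ) : ℝ≥0∞) ^ d * a (q * k)) atTop := by
  obtain ⟨B, hB⟩ := exists_bounded_shift ha hq
  choose j h1 h2 h3 using hB
  have hj : Tendsto j atTop atTop := by
    refine tendsto_atTop.2 fun b => ?_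
    filter_upwards [eventually_ge_atTop (q * b)] with k hk
    exact Nat.le_of_mul_le_mul_left (hk.trans (h1 k)) hq
  set w : ℕ → ℝ≥0∞ := fun k => c / ((q * k : ℕ) : ℝ≥0∞) ^ d * a (q * k) with hw
  have hbound : ∀ᶠ k : ℕ in atTop, c / (k : ℝ≥0∞) ^ d * a k ≤
      ((fun k : ℕ => (1 + (B : ℝ≥0∞) / k) ^ d) * (w ∘ j)) k := by
    filter_upwards [eventually_ge_atTop 1] with k hk
    have hk0 : (k : ℝ≥0∞) ≠ 0 := by exact_mod_cast (by omega : k ≠ 0)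
    have hkt : (k : ℝ≥0∞) ≠ ⊤ := ENNReal.natCast_ne_top k
    set K : ℝ≥0∞ := ((q * j k : ℕ) : ℝ≥0∞) with hK
    have hK0 : K ≠ 0 := by
      have : q * j k ≠ 0 := by have := h1 k; omega
      rw [hK]
      exact_mod_cast this
    have hKt : K ≠ ⊤ := ENNReal.natCast_ne_top _
    have hle : K / k ≤ 1 + (B : ℝ≥0∞) / k := by
      rw [← ENNReal.div_self hk0 hkt, ← ENNReal.add_div]
      gcongr
      rw [hK]
      exact_mod_cast h2 k
    have hcoef : c / (k : ℝ≥0∞) ^ d = (K / k) ^ d * (c / K ^ d) := by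
      have hcancel : K ^ d * (K ^ d)⁻¹ = 1 :=
        ENNReal.mul_inv_cancel (pow_ne_zero d hK0) (ENNReal.pow_ne_top hKt)
      simp only [div_eq_mul_inv, mul_pow]
      rw [← ENNReal.inv_pow (a := (k : ℝ≥0∞))]
      calc c * ((k : ℝ≥0∞) ^ d)⁻¹ = (K ^ d * (K ^ d)⁻¹) * (c * ((k : ℝ≥0∞) ^ d)⁻¹) := by
            rw [hcancel, one_mul]
        _ = _ := by ring
    calc c / (k : ℝ≥0∞) ^ d * a k ≤ c / (k : ℝ≥0∞) ^ d * a (q * j k) := by gcongr; exact h3 k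
      _ = (K / k) ^ d * (c / K ^ d * a (q * j k)) := by rw [hcoef, mul_assoc]
      _ ≤ (1 + (B : ℝ≥0∞) / k) ^ d * (c / K ^ d * a (q * j k)) := by gcongr
  have hlim := (tendsto_one_add_div_pow B d).limsup_eq
  calc _ ≤ limsup ((fun k : ℕ => (1 + (B : ℝ≥0∞) / k) ^ d) * (w ∘ j)) atTop :=
        limsup_le_limsup hbound
    _ ≤ limsup (fun k : ℕ => (1 + (B : ℝ≥0∞) / k) ^ d) atTop * limsup (w ∘ j) atTop :=
        ENNReal.limsup_mul_le' (Or.inl (by simp [hlim])) (Or.inl (by simp [hlim]))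
    _ = limsup w (map j atTop) := by rw [hlim, one_mul]; rfl
    _ ≤ limsup w atTop := limsup_le_limsup_of_le hj

theorem limsup_homogeneous {a : ℕ → ℝ≥0∞} (ha : ∀ k m, a m ≠ 0 → a k ≤ a (k + m)) {q : ℕ}
    (hq : 1 ≤ q) (c : ℝ≥0∞) (d : ℕ) :
    limsup (fun k : ℕ => c / (k : ℝ≥0∞) ^ d * a (q * k)) atTop =
      (q : ℝ≥0∞) ^ d * limsup (fun k : ℕ => c / (k : ℝ≥0∞) ^ d * a k) atTop := by
  have hq0 : (q : ℝ≥0∞) ≠ 0 := by exact_mod_cast (by omega : q ≠ 0)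
  have hqt : (q : ℝ≥0∞) ^ d ≠ ⊤ := ENNReal.pow_ne_top (ENNReal.natCast_ne_top q)
  have hscale : (fun k : ℕ => c / (k : ℝ≥0∞) ^ d * a (q * k)) =
      fun k : ℕ => (q : ℝ≥0∞) ^ d * (c / ((q * k : ℕ) : ℝ≥0∞) ^ d * a (q * k)) := by
    funext k
    rw [← mul_assoc, ← mul_div_assoc, Nat.cast_mul, mul_pow,
      ENNReal.mul_div_mul_left _ _ (pow_ne_zero d hq0) hqt]
  have hmul : Tendsto (fun k : ℕ => q * k) atTop atTop :=
    tendsto_id.const_mul_atTop' hq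
  rw [hscale, ENNReal.limsup_const_mul_of_ne_top hqt]
  congr 1
  refine le_antisymm ?_ (limsup_le_limsup_mul ha hq c d)
  exact limsup_le_limsup_of_le (u := fun k : ℕ => c / (k : ℝ≥0∞) ^ d * a k) hmul

theorem vol0_pow {G : Type*} [Group G] [TopologicalSpace G] {N : ℕ} {X : Set (ProjSpace N)}
    [MulAction G X] [HolomorphicAction G X] (hX : IsProjectiveVariety X) (n g : ℕ) (L : PicG G X)
    {q : ℕ} (hq : 1 ≤ q) : vol0 n g (L ^ q) = (q : ℝ≥0∞) ^ (n - g) * vol0 n g L := by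
  have ha : ∀ k m : ℕ, (h0Inv (L ^ m) : ℝ≥0∞) ≠ 0 →
      (h0Inv (L ^ k) : ℝ≥0∞) ≤ (h0Inv (L ^ (k + m)) : ℝ≥0∞) := by
    intro k m hm
    rw [pow_add]
    exact ENat.toENNReal_le.2 (h0Inv_le_mul hX _ (by simpa using hm))
  simp only [vol0, ← pow_mul]
  exact limsup_homogeneous ha hq _ _

/-! ### Homogeneous functions on rational classes -/

section Extension

variable {A : Type*} [AddCommGroup A]

/-- Every element of `ℚ ⊗ A` is a fraction with a single positive denominator. -/
theorem exists_eq_inv_smul_one_tmul (x : ℚ ⊗[ℤ] A) :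
    ∃ (m : ℕ) (a : A), 0 < m ∧ x = (m : ℚ)⁻¹ • ((1 : ℚ) ⊗ₜ[ℤ] a) := by
  induction x with
  | zero => exact ⟨1, 0, one_pos, by simp⟩
  | tmul c a =>
    refine ⟨c.den, c.num • a, c.den_pos, ?_⟩
    rw [← TensorProduct.smul_tmul, TensorProduct.smul_tmul']
    congr 1
    rw [zsmul_eq_mul, mul_one, smul_eq_mul, mul_comm, ← div_eq_mul_inv, Rat.num_div_den]
  | add x y hx hy =>
    obtain ⟨m, a, hm, rfl⟩ := hx
    obtain ⟨m', a', hm', rfl⟩ := hy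
    refine ⟨m * m', m' • a + m • a', Nat.mul_pos hm hm', ?_⟩
    have h1 : (m : ℚ) ≠ 0 := by exact_mod_cast hm.ne'
    have h2 : (m' : ℚ) ≠ 0 := by exact_mod_cast hm'.ne'
    rw [TensorProduct.tmul_add, TensorProduct.tmul_smul, TensorProduct.tmul_smul,
      ← Nat.cast_smul_eq_nsmul ℚ, ← Nat.cast_smul_eq_nsmul ℚ, smul_add, smul_smul, smul_smul]
    congr 2 <;> (push_cast; field_simp)

/-- The kernel of `A → ℚ ⊗ A` is the torsion of `A`, since `ℚ ⊗ A` is a localization of `A`. -/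
theorem exists_nsmul_eq_of_one_tmul_eq {a b : A} (h : (1 : ℚ) ⊗ₜ[ℤ] a = (1 : ℚ) ⊗ₜ[ℤ] b) :
    ∃ t : ℕ, 0 < t ∧ t • a = t • b := by
  have hloc : IsLocalizedModule (nonZeroDivisors ℤ) (TensorProduct.mk ℤ ℚ A 1) :=
    (isLocalizedModule_iff_isBaseChange (nonZeroDivisors ℤ) ℚ _).2
      (TensorProduct.isBaseChange ℤ A ℚ)
  obtain ⟨c, hc⟩ := (IsLocalizedModule.eq_iff_exists (nonZeroDivisors ℤ)
    (TensorProduct.mk ℤ ℚ A 1)).1 h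
  have hc0 : (c : ℤ) ≠ 0 := nonZeroDivisors.coe_ne_zero c
  have hc' : (c : ℤ) • a = (c : ℤ) • b := hc
  refine ⟨(c : ℤ).natAbs, Int.natAbs_pos.2 hc0, ?_⟩
  rw [← natCast_zsmul, ← natCast_zsmul]
  rcases Int.natAbs_eq (c : ℤ) with h | h
  · rwa [← h]
  · rw [h, neg_smul, neg_smul, neg_inj] at hc'
    exact hc'

theorem existsUnique_homogeneous_extension (d : ℕ) {f : A → ℝ≥0∞}
    (hf : ∀ (a : A) (q : ℕ), 1 ≤ q → f (q • a) = (q : ℝ≥0∞) ^ d * f a) :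
    ∃! v : ℚ ⊗[ℤ] A → ℝ≥0∞, (∀ a, v (1 ⊗ₜ a) = f a) ∧
      ∀ (c : ℚ) (x : ℚ ⊗[ℤ] A), 0 < c → v (c • x) = ENNReal.ofReal (c : ℝ) ^ d * v x := by
  have hofReal : ∀ m : ℕ, 0 < m → ENNReal.ofReal (((m : ℚ)⁻¹ : ℚ) : ℝ) = (m : ℝ≥0∞)⁻¹ := by
    intro m hm
    rw [Rat.cast_inv, Rat.cast_natCast, ENNReal.ofReal_inv_of_pos (by exact_mod_cast hm),
      ENNReal.ofReal_natCast]
  choose den num hden hx using exists_eq_inv_smul_one_tmul (A := A)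
  -- The value does not depend on the way in which a class is written as a fraction.
  have key : ∀ (c : ℚ) (m : ℕ) (a b : A), 0 < c → 0 < m →
      (c • ((1 : ℚ) ⊗ₜ[ℤ] a) : ℚ ⊗[ℤ] A) = (m : ℚ)⁻¹ • ((1 : ℚ) ⊗ₜ[ℤ] b) →
      (m : ℝ≥0∞)⁻¹ ^ d * f b = ENNReal.ofReal (c : ℝ) ^ d * f a := by
    intro c m a b hc hm hab
    obtain ⟨p, hp⟩ : ∃ p : ℕ, (p : ℤ) = c.num := ⟨c.num.toNat, by
      have := Rat.num_pos.2 hc; omega⟩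
    have hp0 : 0 < p := by have := Rat.num_pos.2 hc; omega
    have hcp : c = (p : ℚ) * (c.den : ℚ)⁻¹ := by
      rw [← div_eq_mul_inv, ← Int.cast_natCast (R := ℚ) p, hp, Rat.num_div_den]
    set e := c.den with he
    have he0 : 0 < e := c.den_pos
    have hmQ : (m : ℚ) ≠ 0 := by exact_mod_cast hm.ne'
    have heQ : (e : ℚ) ≠ 0 := by exact_mod_cast he0.ne'
    have hcross : (1 : ℚ) ⊗ₜ[ℤ] ((m * p) • a) = (1 : ℚ) ⊗ₜ[ℤ] (e • b) := by
      have h := congrArg (fun y => ((m : ℚ) * e) • y) hab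
      simp only [smul_smul] at h
      rw [TensorProduct.tmul_smul, TensorProduct.tmul_smul, ← Nat.cast_smul_eq_nsmul ℚ,
        ← Nat.cast_smul_eq_nsmul ℚ]
      convert h using 2
      · rw [hcp]; push_cast; field_simp
      · field_simp
    -- Clearing denominators gives an identity in `A` up to torsion, which homogeneity of `f` absorbs.
    obtain ⟨t, ht, htab⟩ := exists_nsmul_eq_of_one_tmul_eq hcross
    have hval := congrArg f htab
    rw [hf _ _ ht, hf _ _ ht, hf _ _ (Nat.mul_pos hm hp0), hf _ _ he0] at hval
    have hne : ∀ k : ℕ, 0 < k → (k : ℝ≥0∞) ^ d ≠ 0 ∧ (k : ℝ≥0∞) ^ d ≠ ⊤ := fun k hk =>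
      ⟨pow_ne_zero d (by exact_mod_cast hk.ne'), ENNReal.pow_ne_top (ENNReal.natCast_ne_top k)⟩
    have hval' := (ENNReal.mul_right_inj (hne t ht).1 (hne t ht).2).1 hval
    have hcr : ENNReal.ofReal (c : ℝ) = (p : ℝ≥0∞) * (e : ℝ≥0∞)⁻¹ := by
      conv_lhs => rw [hcp]
      rw [Rat.cast_mul, ENNReal.ofReal_mul (by positivity), hofReal e he0, Rat.cast_natCast,
        ENNReal.ofReal_natCast]
    have hm1 : (m : ℝ≥0∞)⁻¹ ^ d * (m : ℝ≥0∞) ^ d = 1 := by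
      rw [← ENNReal.inv_pow]
      exact ENNReal.inv_mul_cancel (hne m hm).1 (hne m hm).2
    have he1 : (e : ℝ≥0∞)⁻¹ ^ d * (e : ℝ≥0∞) ^ d = 1 := by
      rw [← ENNReal.inv_pow]
      exact ENNReal.inv_mul_cancel (hne e he0).1 (hne e he0).2
    calc (m : ℝ≥0∞)⁻¹ ^ d * f b
        = (m : ℝ≥0∞)⁻¹ ^ d * ((e : ℝ≥0∞)⁻¹ ^ d * (e : ℝ≥0∞) ^ d) * f b := by rw [he1, mul_one]
      _ = (m : ℝ≥0∞)⁻¹ ^ d * (e : ℝ≥0∞)⁻¹ ^ d * ((e : ℝ≥0∞) ^ d * f b) := by ring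
      _ = ((m : ℝ≥0∞)⁻¹ ^ d * (m : ℝ≥0∞) ^ d) * ((p : ℝ≥0∞) * (e : ℝ≥0∞)⁻¹) ^ d * f a := by
        rw [← hval', Nat.cast_mul]; ring
      _ = ENNReal.ofReal (c : ℝ) ^ d * f a := by rw [hm1, one_mul, hcr]
  refine ⟨fun x => (den x : ℝ≥0∞)⁻¹ ^ d * f (num x), ⟨fun a => ?_, fun c x hc => ?_⟩, ?_⟩
  · have h := key 1 (den (1 ⊗ₜ a)) a (num (1 ⊗ₜ a)) one_pos (hden _)
      ((one_smul ℚ _).trans (hx (1 ⊗ₜ a)))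
    simpa using h
  · have hm : (den x : ℚ) ≠ 0 := by exact_mod_cast (hden x).ne'
    have h := key (c * (den x : ℚ)⁻¹) (den (c • x)) (num x) (num (c • x))
      (mul_pos hc (inv_pos.2 (by exact_mod_cast hden x))) (hden _) (by
        rw [mul_smul, ← hx x]; exact hx (c • x))
    refine h.trans ?_
    rw [Rat.cast_mul, ENNReal.ofReal_mul (by exact_mod_cast hc.le), hofReal _ (hden x), mul_pow,
      mul_assoc]
  · rintro v ⟨hv1, hv2⟩
    funext x
    conv_lhs => rw [hx x]
    rw [hv2 _ _ (inv_pos.2 (by exact_mod_cast hden x)), hv1, hofReal _ (hden x)]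

end Extension

end EquivVol

end

open EquivVol in
theorem mainTheorem6 {N n g : ℕ} (M : Set (ProjSpace N)) (hM : IsProjectiveVariety M)
    (hn : dimension M = n)
    (G : Type*) [Group G] [TopologicalSpace G] [T2Space G] [CompactSpace G] [ConnectedSpace G]
    [ChartedSpace (EuclideanSpace ℝ (Fin g)) G] [LieGroup (𝓡 g) ∞ G]
    [MulAction G M] [HolomorphicAction G M] (hgn : g ≤ n) :
    (∀ (L : PicG G M) (q : ℕ), 1 ≤ q → vol0 n g (L ^ q) = (q : ℝ≥0∞) ^ (n - g) * vol0 n g L) ∧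
    (∀ P : Subgroup (PicG G M),
      (∀ L L' : PicG G M, L / L' ∈ P → vol0 n g L = vol0 n g L') →
      ∃! v : ℚ ⊗[ℤ] Additive (PicG G M ⧸ P) → ℝ≥0∞,
        (∀ L : PicG G M, v (ratClass P L) = vol0 n g L) ∧
        (∀ (c : ℚ) (x : ℚ ⊗[ℤ] Additive (PicG G M ⧸ P)), 0 < c →
          v (c • x) = ENNReal.ofReal (c : ℝ) ^ (n - g) * v x)) := by
  refine ⟨fun L q hq => vol0_pow hM n g L hq, fun P hP => ?_⟩
  let f : Additive (PicG G M ⧸ P) → ℝ≥0∞ := fun a =>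
    Quotient.lift (vol0 n g) (fun L L' h => hP L L' (by
      have h' := P.inv_mem (QuotientGroup.leftRel_apply.1 h)
      rwa [mul_inv_rev, inv_inv, mul_comm, ← div_eq_mul_inv] at h')) a.toMul
  have hf : ∀ (a : Additive (PicG G M ⧸ P)) (q : ℕ), 1 ≤ q →
      f (q • a) = (q : ℝ≥0∞) ^ (n - g) * f a := by
    intro a q hq
    obtain ⟨L, hL⟩ := QuotientGroup.mk_surjective a.toMul
    obtain rfl : Additive.ofMul (QuotientGroup.mk L) = a := hL
    exact vol0_pow hM n g L hq
  obtain ⟨v, ⟨hv1, hv2⟩, huniq⟩ := existsUnique_homogeneous_extension (n - g) hf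
  refine ⟨v, ⟨fun L => hv1 _, hv2⟩, fun w ⟨hw1, hw2⟩ => huniq w ⟨fun a => ?_, hw2⟩⟩
  obtain ⟨L, hL⟩ := QuotientGroup.mk_surjective a.toMul
  obtain rfl : Additive.ofMul (QuotientGroup.mk L) = a := hL
  exact hw1 L
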